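/- **Proposition 3.8** (Gauss–Green formula in $S^{\alpha,1}\cap L^\infty$). Let $n\in\mathbb{N}$ and $\alpha\in(0,1)$. For $\phi\in C_c^\infty(\mathbb{R}^n;\mathbb{R}^n)$ let $$\operatorname{div}^\alpha\phi(x)=\mu_{n,\alpha}\int_{\mathbb{R}^n}\frac{(y-x)\cdot(\phi(y)-\phi(x))}{|y-x|^{n+\alpha+1}}\,dy,\qquad x\in\mathbb{R}^n,\qquad \mu_{n,\alpha}=2^\alpha\pi^{-\frac n2}\,\frac{\Gamma\left(\frac{n+\alpha+1}2\right)}{\Gamma\left(\frac{1-\alpha}2\right)}.$$ Let $S^{\alpha,1}(\mathbb{R}^n)$ be the space of all $f\in L^1(\mathbb{R}^n)$ for which there exists a function $\nabla^\alpha f\in L^1(\mathbb{R}^n;\mathbb{R}^n)$, the weak fractional $\alpha$-gradient of $f$ (unique up to a.e. equality), such that $$\int_{\mathbb{R}^n}f\,\operatorname{div}^\alpha\phi\,dx=-\int_{\mathbb{R}^n}\phi\cdot\nabla^\alpha f\,dx\qquad\text{for all }\phi\in C_c^\infty(\mathbb{R}^n;\mathbb{R}^n).$$ If $f,g\in S^{\alpha,1}(\mathbb{R}^n)\cap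 L^\infty(\mathbb{R}^n)$, then $f\,\nabla^\alpha g$ and $g\,\nabla^\alpha f$ belong to $L^1(\mathbb{R}^n;\mathbb{R}^n)$ and $$\int_{\mathbb{R}^n}f\,\nabla^\alpha g\,dx=-\int_{\mathbb{R}^n}g\,\nabla^\alpha f\,dx .$$ -/

import Mathlib

open MeasureTheory
open scoped ENNReal ContDiff

noncomputable section

/-- The normalising constant `μ_{n,α} = 2^α π^{-n/2} Γ((n+α+1)/2) / Γ((1-α)/2)`. -/
def fracConst (n : ℕ) (α : ℝ) : ℝ :=
  (2 : ℝ) ^ α * Real.pi ^ (-((n : ℝ) / 2)) *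
    (Real.Gamma (((n : ℝ) + α + 1) / 2) / Real.Gamma ((1 - α) / 2))

/-- The fractional `α`-divergence
`div^α φ (x) = μ_{n,α} ∫ (y - x) · (φ(y) - φ(x)) / |y - x|^{n+α+1} dy`.
For `α ∈ (0,1)` and `φ` Lipschitz with compact support the integrand is Lebesgue integrable. -/
def fracDiv {n : ℕ} (α : ℝ) (φ : EuclideanSpace ℝ (Fin n) → EuclideanSpace ℝ (Fin n))
    (x : EuclideanSpace ℝ (Fin n)) : ℝ :=
  fracConst n α *
    ∫ y : EuclideanSpace ℝ (Fin n),
      inner ℝ (y - x) (φ y - φ x) / ‖y - x‖ ^ ((n : ℝ) + α + 1)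

/-- `F` is (a representative of) the weak fractional `α`-gradient, in `L^p(ℝⁿ; ℝⁿ)`, of `f`:
`∫ f div^α φ dx = - ∫ φ · F dx` for every `φ ∈ C_c^∞(ℝⁿ; ℝⁿ)`. -/
def IsWeakFracGrad {n : ℕ} (α : ℝ) (p : ℝ≥0∞) (f : EuclideanSpace ℝ (Fin n) → ℝ)
    (F : EuclideanSpace ℝ (Fin n) → EuclideanSpace ℝ (Fin n)) : Prop :=
  MemLp F p volume ∧
    ∀ φ : EuclideanSpace ℝ (Fin n) → EuclideanSpace ℝ (Fin n),
      ContDiff ℝ ∞ φ → HasCompactSupport φ →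
        ∫ x, f x * fracDiv α φ x = -∫ x, inner ℝ (φ x) (F x)

/-- Membership in the distributional fractional Sobolev space `S^{α,p}(ℝⁿ)`: `f ∈ L^p(ℝⁿ)` and
`f` has a weak fractional `α`-gradient in `L^p(ℝⁿ; ℝⁿ)`. -/
def MemFracSobolev {n : ℕ} (α : ℝ) (p : ℝ≥0∞) (f : EuclideanSpace ℝ (Fin n) → ℝ) : Prop :=
  MemLp f p volume ∧
    ∃ F : EuclideanSpace ℝ (Fin n) → EuclideanSpace ℝ (Fin n), IsWeakFracGrad α p f F

end

/-! Fix a direction `v` and an even mollifier `ρ`. Translates and reflections of `ρ v` are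
admissible test fields, so pairing `F` or `G` with them replaces `ρ` by the kernel `K = fracDiv α (ρ
v)` acting on `f` or `g`. As `K` is bounded and `f`, `g` are integrable, Fubini moves `K` from one
function to the other; this is the formula with the scalar factors mollified
(`integral_inner_mul_mollified`). Boundedness of `f`, `g` then allows dominated convergence as `ρ`
concentrates at the origin. -/

section FractionalKernel

open Set Module

/-- The radial majorant `r · min(L r, M) / r^{n+α+1}` is integrable on an `n`-dimensional space. -/
lemma integrable_radial_majorant {E : Type*} [NormedAddCommGroup E] [NormedSpace ℝ E]
    [FiniteDimensional ℝ E] [MeasurableSpace E] [BorelSpace E] [Nontrivial E]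
    (μ : Measure E) [μ.IsAddHaarMeasure]
    {α L M : ℝ} (hα0 : 0 < α) (hα1 : α < 1) (hL : 0 ≤ L) (hM : 0 ≤ M) :
    Integrable (fun h : E => ‖h‖ * min (L * ‖h‖) M / ‖h‖ ^ ((finrank ℝ E : ℝ) + α + 1)) μ := by
  have hd : 1 ≤ finrank ℝ E := finrank_pos
  refine (integrable_fun_norm_addHaar μ
    (f := fun r => r * min (L * r) M / r ^ ((finrank ℝ E : ℝ) + α + 1))).2 ?_
  have hmeas : Measurable (fun r : ℝ => r ^ (finrank ℝ E - 1) •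
      (r * min (L * r) M / r ^ ((finrank ℝ E : ℝ) + α + 1))) := by
    simp only [smul_eq_mul]
    fun_prop
  have hpow : ∀ r : ℝ, 0 < r → r ^ (finrank ℝ E - 1) •
      (r * min (L * r) M / r ^ ((finrank ℝ E : ℝ) + α + 1)) =
        min (L * r) M * r ^ (-1 - α) := by
    intro r hr
    have h1 : r ^ (finrank ℝ E - 1) * r = r ^ (finrank ℝ E : ℝ) := by
      rw [Real.rpow_natCast, ← pow_succ, Nat.sub_add_cancel hd]
    have h2 : r ^ ((finrank ℝ E : ℝ)) / r ^ ((finrank ℝ E : ℝ) + α + 1) = r ^ (-1 - α) := by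
      rw [← Real.rpow_sub hr]; congr 1; ring
    rw [smul_eq_mul, ← h2, ← h1]
    ring
  -- Near 0 the bound is `L r^(-α)`, integrable as `α < 1`; beyond 1 it is `M r^(-1-α)`, integrable
  -- as `α > 0`.
  rw [← Ioc_union_Ioi_eq_Ioi zero_le_one]
  refine IntegrableOn.union ?_ ?_
  · have hint : IntegrableOn (fun r : ℝ => L * r ^ (-α)) (Ioc 0 1) :=
      ((intervalIntegrable_iff_integrableOn_Ioc_of_le zero_le_one).1
        (intervalIntegral.intervalIntegrable_rpow' (by linarith))).const_mul L
    refine Integrable.mono' hint hmeas.aestronglyMeasurable ?_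
    refine ae_restrict_of_forall_mem measurableSet_Ioc fun r hr => ?_
    have hr0 : 0 < r := hr.1
    rw [hpow r hr0, Real.norm_of_nonneg (by positivity)]
    have h3 : r * r ^ (-1 - α) = r ^ (-α) := by
      nth_rewrite 1 [← Real.rpow_one r]
      rw [← Real.rpow_add hr0]; congr 1; ring
    rw [← h3, ← mul_assoc]
    gcongr
    exact min_le_left _ _
  · have hint : IntegrableOn (fun r : ℝ => M * r ^ (-1 - α)) (Ioi 1) :=
      (integrableOn_Ioi_rpow_of_lt (by linarith) zero_lt_one).const_mul M
    refine Integrable.mono' hint hmeas.aestronglyMeasurable ?_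
    refine ae_restrict_of_forall_mem measurableSet_Ioi fun r hr => ?_
    have hr0 : 0 < r := zero_lt_one.trans hr
    rw [hpow r hr0, Real.norm_of_nonneg (by positivity)]
    gcongr
    exact min_le_right _ _

/-- The increment of `φ` is at most `L‖y - x‖` by the Lipschitz bound and at most `2M` by the sup
bound; the resulting majorant depends only on `y - x`, so its integral is independent of `x`. -/
lemma exists_abs_fracDiv_le {n : ℕ} [Nontrivial (EuclideanSpace ℝ (Fin n))] {α : ℝ}
    (hα0 : 0 < α) (hα1 : α < 1)
    {φ : EuclideanSpace ℝ (Fin n) → EuclideanSpace ℝ (Fin n)}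
    (hφ : ContDiff ℝ ∞ φ) (hφc : HasCompactSupport φ) :
    ∃ C : ℝ, ∀ x, |fracDiv α φ x| ≤ C := by
  obtain ⟨L, hL⟩ := hφ.lipschitzWith_of_hasCompactSupport hφc (by simp)
  obtain ⟨M, hM⟩ := hφc.exists_bound_of_continuous hφ.continuous
  have hM0 : 0 ≤ M := (norm_nonneg _).trans (hM 0)
  have hk := integrable_radial_majorant (E := EuclideanSpace ℝ (Fin n)) volume hα0 hα1
    L.coe_nonneg (M := M + M) (by positivity)
  rw [finrank_euclideanSpace_fin] at hk
  set k : EuclideanSpace ℝ (Fin n) → ℝ :=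
    fun h => ‖h‖ * min (L * ‖h‖) (M + M) / ‖h‖ ^ ((n : ℝ) + α + 1) with hk_def
  refine ⟨|fracConst n α| * ∫ y, k y, fun x => ?_⟩
  rw [fracDiv, abs_mul]
  gcongr
  rw [← integral_sub_right_eq_self k x, ← Real.norm_eq_abs]
  refine norm_integral_le_of_norm_le (hk.comp_sub_right x) (.of_forall fun y => ?_)
  have hpos : 0 ≤ ‖y - x‖ ^ ((n : ℝ) + α + 1) := by positivity
  rw [norm_div, Real.norm_of_nonneg hpos]
  simp only [hk_def]
  gcongr
  refine (norm_inner_le_norm _ _).trans ?_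
  gcongr
  refine le_min ?_ ((norm_sub_le _ _).trans (add_le_add (hM y) (hM x)))
  simpa [dist_eq_norm] using hL.dist_le_mul y x

lemma measurable_fracDiv {n : ℕ} (α : ℝ)
    {φ : EuclideanSpace ℝ (Fin n) → EuclideanSpace ℝ (Fin n)} (hφ : Continuous φ) :
    Measurable (fracDiv α φ) := by
  unfold fracDiv
  refine Measurable.const_mul ?_ _
  refine StronglyMeasurable.measurable ?_
  refine StronglyMeasurable.integral_prod_right' (f := fun p : EuclideanSpace ℝ (Fin n) ×
    EuclideanSpace ℝ (Fin n) =>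
      inner ℝ (p.2 - p.1) (φ p.2 - φ p.1) / ‖p.2 - p.1‖ ^ ((n : ℝ) + α + 1)) ?_
  refine Measurable.stronglyMeasurable ?_
  have h := hφ.measurable
  fun_prop

lemma fracDiv_comp_sub_right {n : ℕ} (α : ℝ)
    (φ : EuclideanSpace ℝ (Fin n) → EuclideanSpace ℝ (Fin n)) (a x : EuclideanSpace ℝ (Fin n)) :
    fracDiv α (fun z => φ (z - a)) x = fracDiv α φ (x - a) := by
  unfold fracDiv
  rw [← integral_sub_right_eq_self (fun y => inner ℝ (y - (x - a)) (φ y - φ (x - a)) /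
    ‖y - (x - a)‖ ^ ((n : ℝ) + α + 1)) a]
  simp only [sub_sub_sub_cancel_right]

/-- Reflection reverses `y - x` but not the increment of `φ`. This sign is the source of the minus
in the Gauss–Green formula. -/
lemma fracDiv_comp_sub_left {n : ℕ} (α : ℝ)
    (φ : EuclideanSpace ℝ (Fin n) → EuclideanSpace ℝ (Fin n)) (a x : EuclideanSpace ℝ (Fin n)) :
    fracDiv α (fun z => φ (a - z)) x = -fracDiv α φ (a - x) := by
  unfold fracDiv
  rw [← integral_sub_left_eq_self (fun y => inner ℝ (y - (a - x)) (φ y - φ (a - x)) /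
    ‖y - (a - x)‖ ^ ((n : ℝ) + α + 1)) volume a, ← mul_neg, ← integral_neg]
  congr 2 with y
  rw [sub_sub_sub_cancel_left, norm_sub_rev, ← neg_div, ← inner_neg_left, neg_sub]

end FractionalKernel

section GaussGreen

open Filter Topology Function ContinuousLinearMap

/-- Fubini's theorem for a bounded convolution kernel. -/
lemma integral_mul_integral_kernel_swap {E : Type*} [NormedAddCommGroup E]
    [MeasurableSpace E] [BorelSpace E] [SecondCountableTopology E] {μ : Measure E} [SFinite μ]
    {u v K : E → ℝ} (hu : Integrable u μ) (hv : Integrable v μ) (hK : Measurable K)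
    {C : ℝ} (hC : ∀ x, |K x| ≤ C) :
    ∫ x, u x * ∫ y, K (x - y) * v y ∂μ ∂μ = ∫ y, v y * ∫ x, K (x - y) * u x ∂μ ∂μ := by
  simp_rw [← integral_const_mul]
  rw [integral_integral_swap]
  · congr with y
    congr with x
    ring
  · have hK' : Measurable fun p : E × E => K (p.1 - p.2) := by fun_prop
    refine ((hu.mul_prod hv).bdd_mul (c := C) hK'.aestronglyMeasurable
      (.of_forall fun p => hC _)).congr (.of_forall fun p => ?_)
    simp only [uncurry]
    ring

lemma IsWeakFracGrad.integral_bump_sub_right {n : ℕ} {α : ℝ} {p : ℝ≥0∞}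
    {f : EuclideanSpace ℝ (Fin n) → ℝ}
    {F : EuclideanSpace ℝ (Fin n) → EuclideanSpace ℝ (Fin n)} (hF : IsWeakFracGrad α p f F)
    {ρ : EuclideanSpace ℝ (Fin n) → ℝ} (hρ : ContDiff ℝ ∞ ρ) (hρc : HasCompactSupport ρ)
    (v a : EuclideanSpace ℝ (Fin n)) :
    ∫ x, ρ (x - a) * inner ℝ v (F x) = -∫ x, fracDiv α (fun z => ρ z • v) (x - a) * f x := by
  have hc : HasCompactSupport fun x => ρ (x - a) • v :=
    (hρc.comp_homeomorph (Homeomorph.subRight a)).smul_right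
  have h := hF.2 (fun x => ρ (x - a) • v)
    ((hρ.comp (contDiff_id.sub contDiff_const)).smul contDiff_const) hc
  simp_rw [real_inner_smul_left, fracDiv_comp_sub_right α (fun z => ρ z • v)] at h
  rw [eq_neg_iff_add_eq_zero, add_comm, ← eq_neg_iff_add_eq_zero, ← h]
  simp_rw [mul_comm]

lemma IsWeakFracGrad.integral_bump_sub_left {n : ℕ} {α : ℝ} {p : ℝ≥0∞}
    {f : EuclideanSpace ℝ (Fin n) → ℝ}
    {F : EuclideanSpace ℝ (Fin n) → EuclideanSpace ℝ (Fin n)} (hF : IsWeakFracGrad α p f F)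
    {ρ : EuclideanSpace ℝ (Fin n) → ℝ} (hρ : ContDiff ℝ ∞ ρ) (hρc : HasCompactSupport ρ)
    (v a : EuclideanSpace ℝ (Fin n)) :
    ∫ x, ρ (a - x) * inner ℝ v (F x) = ∫ x, fracDiv α (fun z => ρ z • v) (a - x) * f x := by
  have hc : HasCompactSupport fun x => ρ (a - x) • v :=
    (hρc.comp_homeomorph (Homeomorph.subLeft a)).smul_right
  have h := hF.2 (fun x => ρ (a - x) • v)
    ((hρ.comp (contDiff_const.sub contDiff_id)).smul contDiff_const) hc
  simp_rw [real_inner_smul_left, fracDiv_comp_sub_left α (fun z => ρ z • v), mul_neg,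
    integral_neg, neg_inj] at h
  rw [← h]
  simp_rw [mul_comm]

/-- The Gauss–Green formula for functions regularised by an even mollifier. -/
lemma IsWeakFracGrad.integral_inner_mul_mollified {n : ℕ} [Nontrivial (EuclideanSpace ℝ (Fin n))]
    {α : ℝ} (hα0 : 0 < α) (hα1 : α < 1) {f g : EuclideanSpace ℝ (Fin n) → ℝ}
    (hf : Integrable f) (hg : Integrable g)
    {F G : EuclideanSpace ℝ (Fin n) → EuclideanSpace ℝ (Fin n)}
    (hF : IsWeakFracGrad α 1 f F) (hG : IsWeakFracGrad α 1 g G)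
    {ρ : EuclideanSpace ℝ (Fin n) → ℝ} (hρ : ContDiff ℝ ∞ ρ) (hρc : HasCompactSupport ρ)
    (hρ_even : ∀ x, ρ (-x) = ρ x) (v : EuclideanSpace ℝ (Fin n)) :
    ∫ x, inner ℝ v (G x) * ∫ y, ρ (x - y) * f y =
      -∫ x, inner ℝ v (F x) * ∫ y, ρ (x - y) * g y := by
  have hFi : Integrable fun x => inner ℝ v (F x) := (memLp_one_iff_integrable.1 hF.1).const_inner v
  have hGi : Integrable fun x => inner ℝ v (G x) := (memLp_one_iff_integrable.1 hG.1).const_inner v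
  obtain ⟨B, hB⟩ := hρc.exists_bound_of_continuous hρ.continuous
  have hφ : ContDiff ℝ ∞ fun z => ρ z • v := hρ.smul contDiff_const
  obtain ⟨C, hC⟩ := exists_abs_fracDiv_le hα0 hα1 hφ hρc.smul_right
  have hK := measurable_fracDiv α hφ.continuous
  calc ∫ x, inner ℝ v (G x) * ∫ y, ρ (x - y) * f y
      = ∫ y, f y * ∫ x, ρ (x - y) * inner ℝ v (G x) :=
        integral_mul_integral_kernel_swap hGi hf hρ.continuous.measurable hB
    _ = -∫ y, f y * ∫ x, fracDiv α (fun z => ρ z • v) (x - y) * g x := by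
        simp_rw [hG.integral_bump_sub_right hρ hρc, mul_neg, integral_neg]
    _ = -∫ x, g x * ∫ y, fracDiv α (fun z => ρ z • v) (x - y) * f y := by
        rw [integral_mul_integral_kernel_swap hg hf hK hC]
    _ = -∫ x, g x * ∫ y, ρ (x - y) * inner ℝ v (F y) := by
        simp_rw [hF.integral_bump_sub_left hρ hρc]
    _ = -∫ y, inner ℝ v (F y) * ∫ x, ρ (x - y) * g x := by
        rw [integral_mul_integral_kernel_swap hg hFi hρ.continuous.measurable hB]
    _ = -∫ x, inner ℝ v (F x) * ∫ y, ρ (x - y) * g y := by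
        -- The only use of the evenness of `ρ`.
        congr with x
        congr with y
        rw [← hρ_even, neg_sub]

/-- Pairing an integrable function with the mollifications of a bounded integrable function
passes to the limit. -/
lemma tendsto_integral_mul_mollified {E : Type*} [NormedAddCommGroup E] [InnerProductSpace ℝ E]
    [FiniteDimensional ℝ E] [MeasurableSpace E] [BorelSpace E] {μ : Measure E}
    [μ.IsAddHaarMeasure] {u f : E → ℝ} (hu : Integrable u μ) (hf : Integrable f μ)
    (hf_bdd : MemLp f ∞ μ) {φ : ℕ → ContDiffBump (0 : E)} {K : ℝ}
    (hφ : Tendsto (fun i => (φ i).rOut) atTop (𝓝 0)) (hφK : ∀ i, (φ i).rOut ≤ K * (φ i).rIn) :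
    Tendsto (fun i => ∫ x, u x * ∫ y, (φ i).normed μ (x - y) * f y ∂μ ∂μ) atTop
      (𝓝 (∫ x, u x * f x ∂μ)) := by
  obtain ⟨M, hM⟩ : ∃ M : ℝ, ∀ᵐ x ∂μ, ‖f x‖ ≤ M :=
    (eLpNormEssSup_lt_top_iff_isBoundedUnder.1 (by simpa using hf_bdd.2)).elim fun M hM => ⟨M, hM⟩
  -- Convergence at almost every point by Lebesgue differentiation, which needs the ratio of the
  -- bump radii bounded.
  have hconv := ContDiffBump.ae_convolution_tendsto_right_of_locallyIntegrable (μ := μ) hφ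
    (.of_forall hφK) hf.locallyIntegrable
  refine tendsto_integral_of_dominated_convergence (fun x => ‖u x‖ * M) (fun i => ?_)
    (hu.norm.mul_const M) (fun i => .of_forall fun x => ?_) ?_
  · refine hu.aestronglyMeasurable.mul ?_
    have h : AEStronglyMeasurable (fun p : E × E => (φ i).normed μ (p.1 - p.2) * f p.2)
        (μ.prod μ) := by
      have h1 := (φ i).continuous_normed (μ := μ)
      exact (by fun_prop : Continuous fun p : E × E => (φ i).normed μ (p.1 - p.2))
        |>.aestronglyMeasurable.mul hf.aestronglyMeasurable.comp_snd
    exact h.integral_prod_right'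
  · rw [norm_mul]
    gcongr
    have hi : Integrable (fun y => (φ i).normed μ (x - y)) μ :=
      (φ i).integrable_normed.comp_sub_left x
    calc ‖∫ y, (φ i).normed μ (x - y) * f y ∂μ‖
        ≤ ∫ y, (φ i).normed μ (x - y) * M ∂μ := by
          refine norm_integral_le_of_norm_le (hi.mul_const M) ?_
          filter_upwards [hM] with y hy
          rw [norm_mul, Real.norm_of_nonneg ((φ i).nonneg_normed _)]
          exact mul_le_mul_of_nonneg_left hy ((φ i).nonneg_normed _)
      _ = M := by
          rw [integral_mul_const, integral_sub_left_eq_self (fun z => (φ i).normed μ z) μ x,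
            (φ i).integral_normed, one_mul]
  · filter_upwards [hconv] with x hx
    refine Tendsto.const_mul _ (hx.congr fun i => ?_)
    rw [convolution_eq_swap]
    simp

theorem proposition3p8 {n : ℕ} {α : ℝ} (hα0 : 0 < α) (hα1 : α < 1)
    (f g : EuclideanSpace ℝ (Fin n) → ℝ)
    (hf : MemFracSobolev α 1 f) (hf_bdd : MemLp f ∞ volume)
    (hg : MemFracSobolev α 1 g) (hg_bdd : MemLp g ∞ volume)
    (F G : EuclideanSpace ℝ (Fin n) → EuclideanSpace ℝ (Fin n))
    (hF : IsWeakFracGrad α 1 f F) (hG : IsWeakFracGrad α 1 g G) :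
    Integrable (fun x => f x • G x) volume ∧
      Integrable (fun x => g x • F x) volume ∧
      ∫ x, f x • G x = -∫ x, g x • F x := by
  have hFi : Integrable F := memLp_one_iff_integrable.1 hF.1
  have hGi : Integrable G := memLp_one_iff_integrable.1 hG.1
  have hfi : Integrable f := memLp_one_iff_integrable.1 hf.1
  have hgi : Integrable g := memLp_one_iff_integrable.1 hg.1
  have hfG : Integrable (fun x => f x • G x) := hGi.smul_of_top_right hf_bdd
  have hgF : Integrable (fun x => g x • F x) := hFi.smul_of_top_right hg_bdd
  refine ⟨hfG, hgF, ?_⟩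
  -- For `n = 0` both sides lie in the zero space; the radial estimate needs `n ≥ 1`.
  rcases subsingleton_or_nontrivial (EuclideanSpace ℝ (Fin n)) with _ | _
  · exact Subsingleton.elim _ _
  refine ext_inner_left ℝ fun v => ?_
  rw [inner_neg_right, ← integral_inner hfG, ← integral_inner hgF]
  simp_rw [real_inner_smul_right]
  let φ : ℕ → ContDiffBump (0 : EuclideanSpace ℝ (Fin n)) := fun i =>
    ⟨1 / ((i : ℝ) + 1), 2 * (1 / ((i : ℝ) + 1)), by positivity, by
      have : 0 < 1 / ((i : ℝ) + 1) := by positivity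
      linarith⟩
  have hφ : Tendsto (fun i => (φ i).rOut) atTop (𝓝 0) := by
    simpa [φ] using (tendsto_one_div_add_atTop_nhds_zero_nat (𝕜 := ℝ)).const_mul 2
  have hφK : ∀ i, (φ i).rOut ≤ 2 * (φ i).rIn := fun i => le_rfl
  have hlimG := tendsto_integral_mul_mollified (hGi.const_inner v) hfi hf_bdd hφ hφK
  have hlimF := tendsto_integral_mul_mollified (hFi.const_inner v) hgi hg_bdd hφ hφK
  have heq := tendsto_nhds_unique hlimG (hlimF.neg.congr fun i =>
    (hF.integral_inner_mul_mollified hα0 hα1 hfi hgi hG (φ i).contDiff_normed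
      (φ i).hasCompactSupport_normed (φ i).normed_neg v).symm)
  simpa only [mul_comm] using heq

end GaussGreen
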